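/- Let $n,m\ge 1$ be integers. Write matrices in $\mathbb{R}^{nm\times nm}$ as $m\times m$ arrays of $n\times n$ blocks $W^{(j,j')}$, let $\operatorname{vec}$ stack the columns of a matrix, and let $\preceq$ be the Loewner order. For a positive semidefinite $A\in\mathbb{R}^{nm\times nm}$ let $W^\star$ be an optimal solution of $$\max_{W\succeq 0}\ \langle A,W\rangle\quad\text{s.t.}\quad \operatorname{tr}(W^{(j,j')})=\delta_{j,j'}\ \ (1\le j,j'\le m),\qquad \sum_{j=1}^m W^{(j,j)}\preceq I_n$$ (feasible points exist only if $n\ge m$), and let $G$ be a random $n\times m$ matrix with $\operatorname{vec}(G)\sim\mathcal N(0,W^\star)$. Let $\sigma_{\max}(G)$ be its largest singular value. Then the entries of $\operatorname{vec}(G)\operatorname{vec}(G)^\top/\sigma_{\max}(G)^2$ are integrable and $$\mathbb{E}\!\left[\frac{\operatorname{vec}(G)\operatorname{vec}(G)^\top}{\sigma_{\max}(G)^2}\right]\succeq \beta_{n,m}\,W^\star,\qquad \beta_{n,m}:=\min_{\lambda\in[0,1]}\int_0^\infty\Bigl(1+2tm\tfrac{1-\lambda}{nm-1}\Bigr)^{-(nm-1)/2}(1+2tm\lambda)^{-3/2}\,dt,$$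 where the integral may be $+\infty$ for some $\lambda$, the minimum is attained and finite, and for $nm=1$ the first factor of the integrand is read as its limit $1$. Moreover: (a) For every $m\ge1$, $\beta_{n,m}$ is non-increasing in $n\ge 1$; and for every fixed $n$ it is non-increasing in $m$ for $1\le m\le n$. (b) For every $m\ge1$, $\beta_{n,m}\to\beta_{\infty,m}$ as $n\to\infty$, where $$\beta_{\infty,m}:=\min_{\lambda\in[0,1]}\int_0^\infty e^{-tm(1-\lambda)}(1+2tm\lambda)^{-3/2}\,dt=\min_{\lambda\in[0,1]}\mathbb{E}_{X\sim\chi^2_1}\!\left[\frac{X}{m(1-\lambda)+m\lambda X}\right],$$ both minima being attained. (c) For $m=1$ and every $n\ge1$, the inequality is tight: for some positive semidefinite $A$ and some optimal solution $W^\star$ as above there is a vector $v$ with $v^\top W^\star v>0$ and $$v^\top\,\mathbb{E}\!\left[\frac{\operatorname{vec}(G)\operatorname{vec}(G)^\top}{\sigma_{\max}(G)^2}\right]v=\beta_{n,1}\,v^\top W^\star v .$$ In particular, $\beta_{n,1}$ is the largest constant $c$ such that $\mathbb{E}[\operatorname{vec}(G)\operatorname{vec}(G)^\top/\sigma_{\max}(G)^2]\succeq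 c\,W^\star$ holds for all such $W^\star$. -/

import Mathlib

open MeasureTheory ProbabilityTheory Filter Topology Set
open scoped ENNReal

noncomputable section

/-- The `(j, j')` block (of size `n × n`) of an `nm × nm` matrix. The `nm` coordinates are indexed
by pairs (column, row), which is the indexing used by `Matrix.vec` (stacking columns). -/
def block {n m : ℕ} (W : Matrix (Fin m × Fin n) (Fin m × Fin n) ℝ) (j j' : Fin m) :
    Matrix (Fin n) (Fin n) ℝ :=
  Matrix.of fun i i' => W (j, i) (j', i')

/-- Feasibility for the Shor relaxation of quadratic optimization over `n × m` matrices with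
orthonormal columns: `W ⪰ 0`, `tr W^(j,j') = δ_{j,j'}` and `∑ j, W^(j,j) ⪯ I`. -/
structure IsShorFeasible {n m : ℕ} (W : Matrix (Fin m × Fin n) (Fin m × Fin n) ℝ) : Prop where
  posSemidef : W.PosSemidef
  trace_block : ∀ j j' : Fin m, (block W j j').trace = if j = j' then 1 else 0
  sum_block_le_one : (1 - ∑ j, block W j j).PosSemidef

/-- `W` is an optimal solution of the Shor relaxation with objective `⟨A, W⟩ = tr (Aᵀ W)`. -/
def IsShorSolution {n m : ℕ} (A W : Matrix (Fin m × Fin n) (Fin m × Fin n) ℝ) : Prop :=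
  IsShorFeasible W ∧
    ∀ W' : Matrix (Fin m × Fin n) (Fin m × Fin n) ℝ, IsShorFeasible W' →
      (A.transpose * W').trace ≤ (A.transpose * W).trace

/-- The largest singular value of a matrix (Mathlib lists singular values in decreasing order). -/
def sigmaMax {n m : ℕ} (G : Matrix (Fin n) (Fin m) ℝ) : ℝ :=
  (Matrix.toEuclideanLin G).singularValues 0

/-- The matrix `vec(G) vec(G)ᵀ / σ_max(G)²`. -/
def normalizedOuter {n m : ℕ} (G : Matrix (Fin n) (Fin m) ℝ) :
    Matrix (Fin m × Fin n) (Fin m × Fin n) ℝ :=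
  (sigmaMax G ^ 2)⁻¹ • Matrix.vecMulVec G.vec G.vec

/-- The (entrywise) expectation `E[vec(G) vec(G)ᵀ / σ_max(G)²]` of a random matrix `G`. -/
def normalizedSecondMoment {n m : ℕ} {Ω : Type*} [MeasurableSpace Ω] (P : Measure Ω)
    (G : Ω → Matrix (Fin n) (Fin m) ℝ) : Matrix (Fin m × Fin n) (Fin m × Fin n) ℝ :=
  Matrix.of fun p q => ∫ ω, normalizedOuter (G ω) p q ∂P

/-- The random matrix `G` satisfies `vec(G) ∼ N(0, W)`. -/
def IsGaussianMatrix {n m : ℕ} {Ω : Type*} [MeasurableSpace Ω] (P : Measure Ω)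
    (G : Ω → Matrix (Fin n) (Fin m) ℝ) (W : Matrix (Fin m × Fin n) (Fin m × Fin n) ℝ) : Prop :=
  HasLaw (fun ω => WithLp.toLp 2 (G ω).vec) (multivariateGaussian 0 W) P

/-- The inverse of vectorization; on the probability space `(ℝ^{nm}, N(0, W))` this is the canonical
random matrix `G` with `vec(G) ∼ N(0, W)`. -/
def unvec {n m : ℕ} (g : EuclideanSpace ℝ (Fin m × Fin n)) : Matrix (Fin n) (Fin m) ℝ :=
  Matrix.of fun i j => g (j, i)

/-- `∫_0^∞ (1 + 2tm(1-λ)/(nm-1))^{-(nm-1)/2} (1 + 2tmλ)^{-3/2} dt`, as an extended nonnegative real: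
it is `+∞` for `λ = 0` when `nm ≤ 3`. When `nm = 1` the first factor of the integrand is `1`
(`x / 0 = 0`, and exponent `0`), which is its limit as `nm - 1` is replaced by `k → 0⁺`. -/
def betaIntegral (n m : ℕ) (l : ℝ) : ℝ≥0∞ :=
  ∫⁻ t in Ioi (0 : ℝ), ENNReal.ofReal
    ((1 + 2 * t * m * ((1 - l) / ((n : ℝ) * m - 1))) ^ (-((n : ℝ) * m - 1) / 2) *
      (1 + 2 * t * m * l) ^ (-(3 / 2) : ℝ))

/-- `β_{n,m}`: the minimum of `betaIntegral n m` over `[0, 1]`, as a real number. -/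
def betaConst (n m : ℕ) : ℝ := (⨅ l ∈ Icc (0 : ℝ) 1, betaIntegral n m l).toReal

/-- `∫_0^∞ e^{-tm(1-λ)} (1 + 2tmλ)^{-3/2} dt`. -/
def betaInfIntegral (m : ℕ) (l : ℝ) : ℝ≥0∞ :=
  ∫⁻ t in Ioi (0 : ℝ), ENNReal.ofReal
    (Real.exp (-(t * m * (1 - l))) * (1 + 2 * t * m * l) ^ (-(3 / 2) : ℝ))

/-- `β_{∞,m}`: the minimum of `betaInfIntegral m` over `[0, 1]`, as a real number. -/
def betaConstInf (m : ℕ) : ℝ := (⨅ l ∈ Icc (0 : ℝ) 1, betaInfIntegral m l).toReal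

/-- The chi-squared distribution with one degree of freedom: the law of `Z²` for `Z ∼ N(0, 1)`. -/
def chiSquaredOne : Measure ℝ := (gaussianReal 0 1).map fun z => z ^ 2

end

/-!
The largest singular value is at most the Frobenius norm, so `E[vec G vec Gᵀ / σ_max²]` dominates
`E[g gᵀ / ‖g‖²]` for the Gaussian vector `g = vec G`. In an orthonormal eigenbasis of `W`, with
eigenvalues `a`, the coordinates of `g` are `√a_i Z_i` for independent standard Gaussians `Z_i`
(`multivariateGaussian_eq_map_pi`). By the symmetry `Z_i ↦ -Z_i` the matrix `E[g gᵀ / ‖g‖²]` is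
diagonal there, with entries `a_i E[Z_i² / ∑ a_j Z_j²]` (`integral_sq_div_eq_sum`). Writing
`X / Y = ∫₀^∞ X exp (-tY) dt` and integrating out each coordinate,
`E[Z_i² / ∑ a_j Z_j²] = ∫₀^∞ (1 + 2 t a_i)^(-3/2) ∏_{j ≠ i} (1 + 2 t a_j)^(-1/2) dt`
(`lintegral_pi_ratio`). Feasibility gives `∑ a_j = tr W = m`; with `a_i = m λ`, the inequality
between the arithmetic and the geometric mean bounds this from below by the integral defining
`β_{n,m}` at `λ` (`betaIntegral_le_lintegral_pi_ratio`), with equality when the other eigenvalues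
coincide.

The integrals are lower semicontinuous in `λ` by Fatou's lemma, so the minima exist. At `λ = 0` they
are at least `1 / m`, which is their value at `λ = 1`, so there is a minimizer `λ > 0`
(`exists_pos_min`). Since `(1 + x / k) ^ k` increases in `k` to `exp x`, by Bernoulli's inequality,
the integrands decrease in `n` and in `m`, and converge as `n → ∞`. For `λ > 0` they are dominated
by the integrable function `(1 + 2 t m λ)^(-3/2)`, which gives the limit `β_{∞,m}`.

For `m = 1` the largest singular value equals the Frobenius norm, and the diagonal matrix with one
eigenvalue the minimizer `λ > 0` and equal remaining ones attains equality in the corresponding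
direction (`exists_tight`). It is optimal for the objective `A = I`, which is constant on feasible
points.
-/

/-! ### The largest singular value -/

/-- The first singular value bounds the stretching of every vector: expand `T† T` in an orthonormal
eigenbasis, all of whose eigenvalues are at most the first one. -/
lemma LinearMap.norm_apply_le_singularValues_zero {E F : Type*}
    [NormedAddCommGroup E] [InnerProductSpace ℝ E] [FiniteDimensional ℝ E]
    [NormedAddCommGroup F] [InnerProductSpace ℝ F] [FiniteDimensional ℝ F]
    (T : E →ₗ[ℝ] F) (x : E) : ‖T x‖ ≤ T.singularValues 0 * ‖x‖ := by
  have hS := T.isSymmetric_adjoint_comp_self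
  set b := hS.eigenvectorBasis rfl
  refine le_of_sq_le_sq ?_ (mul_nonneg (T.singularValues_nonneg 0) (norm_nonneg x))
  have h1 : ‖T x‖ ^ 2 = ∑ i, hS.eigenvalues rfl i * inner ℝ (b i) x ^ 2 := by
    rw [← real_inner_self_eq_norm_sq, ← LinearMap.adjoint_inner_right,
      ← b.sum_inner_mul_inner]
    refine Finset.sum_congr rfl fun i _ => ?_
    have h2 : inner ℝ (b i) ((LinearMap.adjoint T) (T x)) =
        hS.eigenvalues rfl i * inner ℝ (b i) x := by
      have := hS (b i) x
      rw [LinearMap.comp_apply, LinearMap.comp_apply] at this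
      rw [← this, ← LinearMap.comp_apply, hS.apply_eigenvectorBasis rfl i]
      simp [b, real_inner_smul_left]
    rw [h2, real_inner_comm x]
    ring
  rw [h1, mul_pow, ← b.sum_sq_inner_right x, Finset.mul_sum]
  refine Finset.sum_le_sum fun i _ => mul_le_mul_of_nonneg_right ?_ (sq_nonneg _)
  rw [← T.sq_singularValues_fin rfl i]
  exact pow_le_pow_left₀ (T.singularValues_nonneg _) (T.singularValues_antitone (Nat.zero_le _)) 2

lemma sigmaMax_nonneg {n m : ℕ} (G : Matrix (Fin n) (Fin m) ℝ) : 0 ≤ sigmaMax G :=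
  LinearMap.singularValues_nonneg _ _

lemma sigmaMax_eq_opNorm {n m : ℕ} (G : Matrix (Fin n) (Fin m) ℝ) :
    sigmaMax G = ‖LinearMap.toContinuousLinearMap (Matrix.toEuclideanLin G)‖ := by
  set T := Matrix.toEuclideanLin G
  refine le_antisymm ?_ (ContinuousLinearMap.opNorm_le_bound _ (sigmaMax_nonneg G)
    T.norm_apply_le_singularValues_zero)
  rcases Nat.eq_zero_or_pos m with rfl | hm
  · have : T.singularValues 0 = 0 := T.singularValues_of_finrank_le (by simp)
    exact this.le.trans (norm_nonneg _)
  -- an eigenvector of `T† T` for the eigenvalue `σ_max²` is stretched by exactly `σ_max`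
  obtain ⟨x, hx⟩ := (T.hasEigenvalue_adjoint_comp_self_sq_singularValues
    (n := 0) (by simpa using hm)).exists_hasEigenvector
  have h0 : 0 < ‖x‖ := norm_pos_iff.2 hx.2
  have h1 : ‖T x‖ ^ 2 = (T.singularValues 0 * ‖x‖) ^ 2 := by
    rw [← real_inner_self_eq_norm_sq, ← LinearMap.adjoint_inner_right,
      ← LinearMap.comp_apply, hx.apply_eq_smul, real_inner_smul_right,
      real_inner_self_eq_norm_sq, mul_pow]
    rfl
  have h2 : ‖T x‖ = T.singularValues 0 * ‖x‖ :=
    (pow_left_inj₀ (norm_nonneg _) (mul_nonneg (T.singularValues_nonneg 0) h0.le)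
      two_ne_zero).1 h1
  have h3 := (LinearMap.toContinuousLinearMap T).le_opNorm x
  rw [LinearMap.coe_toContinuousLinearMap', h2] at h3
  exact le_of_mul_le_mul_right h3 h0

lemma continuous_sigmaMax {n m : ℕ} :
    Continuous (sigmaMax : Matrix (Fin n) (Fin m) ℝ → ℝ) := by
  have h : (sigmaMax : Matrix (Fin n) (Fin m) ℝ → ℝ) = fun G =>
      ‖((LinearMap.toContinuousLinearMap.toLinearMap ∘ₗ
        (Matrix.toEuclideanLin (𝕜 := ℝ) (m := Fin n) (n := Fin m)).toLinearMap) G)‖ := by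
    funext G
    exact sigmaMax_eq_opNorm G
  rw [h]
  exact continuous_norm.comp (LinearMap.continuous_of_finiteDimensional _)

/-- The largest singular value is at most the Frobenius norm. -/
lemma sigmaMax_sq_le {n m : ℕ} (G : Matrix (Fin n) (Fin m) ℝ) :
    sigmaMax G ^ 2 ≤ ∑ p, G.vec p ^ 2 := by
  have h : sigmaMax G ≤ √(∑ p, G.vec p ^ 2) := by
    rw [sigmaMax_eq_opNorm]
    refine ContinuousLinearMap.opNorm_le_bound _ (Real.sqrt_nonneg _) fun x => ?_
    refine le_of_sq_le_sq ?_ (by positivity)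
    rw [mul_pow, Real.sq_sqrt (Finset.sum_nonneg fun _ _ => sq_nonneg _),
      EuclideanSpace.real_norm_sq_eq, EuclideanSpace.real_norm_sq_eq, Fintype.sum_prod_type_right,
      Finset.sum_mul]
    refine Finset.sum_le_sum fun i _ => ?_
    simpa [Matrix.mulVec, dotProduct, Matrix.vec] using
      Finset.sum_mul_sq_le_sq_mul_sq Finset.univ (fun j => G i j) (fun j => x j)
  calc sigmaMax G ^ 2 ≤ √(∑ p, G.vec p ^ 2) ^ 2 := pow_le_pow_left₀ (sigmaMax_nonneg G) h 2
    _ = _ := Real.sq_sqrt (Finset.sum_nonneg fun _ _ => sq_nonneg _)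

/-- The largest singular value is at least the Euclidean norm of each column. -/
lemma sum_col_sq_le_sigmaMax_sq {n m : ℕ} (G : Matrix (Fin n) (Fin m) ℝ) (j : Fin m) :
    ∑ i, G i j ^ 2 ≤ sigmaMax G ^ 2 := by
  have h := (Matrix.toEuclideanLin G).norm_apply_le_singularValues_zero
    (EuclideanSpace.single j (1 : ℝ))
  rw [PiLp.norm_single, norm_one, mul_one] at h
  have h2 := pow_le_pow_left₀ (norm_nonneg _) h 2
  rw [EuclideanSpace.real_norm_sq_eq] at h2
  simpa [Matrix.toLpLin_apply, sigmaMax] using h2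

lemma vec_sq_le_sigmaMax_sq {n m : ℕ} (G : Matrix (Fin n) (Fin m) ℝ) (p : Fin m × Fin n) :
    G.vec p ^ 2 ≤ sigmaMax G ^ 2 :=
  (Finset.single_le_sum (f := fun i => G i p.1 ^ 2) (fun _ _ => sq_nonneg _)
    (Finset.mem_univ p.2)).trans (sum_col_sq_le_sigmaMax_sq G p.1)

/-- For a single column the largest singular value is the Euclidean norm. -/
lemma sigmaMax_sq_of_col {n : ℕ} (G : Matrix (Fin n) (Fin 1) ℝ) :
    sigmaMax G ^ 2 = ∑ p, G.vec p ^ 2 := by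
  refine le_antisymm (sigmaMax_sq_le G) ?_
  rw [Fintype.sum_prod_type, Fin.sum_univ_one]
  exact sum_col_sq_le_sigmaMax_sq G 0

lemma abs_normalizedOuter_le_one {n m : ℕ} (G : Matrix (Fin n) (Fin m) ℝ) (p q : Fin m × Fin n) :
    |normalizedOuter G p q| ≤ 1 := by
  have h (p) : |G.vec p| ≤ sigmaMax G := abs_le_of_sq_le_sq (vec_sq_le_sigmaMax_sq G p)
    (sigmaMax_nonneg G)
  have hpq : |G.vec p * G.vec q| ≤ sigmaMax G ^ 2 := by
    rw [abs_mul, sq]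
    exact mul_le_mul (h p) (h q) (abs_nonneg _) (sigmaMax_nonneg G)
  rw [normalizedOuter, Matrix.smul_apply, Matrix.vecMulVec_apply, smul_eq_mul, abs_mul,
    abs_of_nonneg (inv_nonneg.2 (sq_nonneg _)), inv_mul_eq_div]
  exact div_le_one_of_le₀ hpq (sq_nonneg _)

lemma dotProduct_normalizedOuter_mulVec {n m : ℕ} (G : Matrix (Fin n) (Fin m) ℝ)
    (v : Fin m × Fin n → ℝ) :
    v ⬝ᵥ (normalizedOuter G).mulVec v = (v ⬝ᵥ G.vec) ^ 2 / sigmaMax G ^ 2 := by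
  rw [normalizedOuter, Matrix.smul_mulVec, dotProduct_smul, Matrix.vecMulVec_mulVec,
    dotProduct_comm G.vec v]
  simp
  ring

/-! ### Gaussian integrals and ratios -/

lemma lintegral_exp_neg_mul_Ioi {a : ℝ} (ha : 0 < a) :
    ∫⁻ t in Ioi (0 : ℝ), ENNReal.ofReal (Real.exp (-(t * a))) = ENNReal.ofReal a⁻¹ := by
  have h1 := integral_exp_mul_Ioi (a := -a) (by linarith) 0
  have h2 := integrableOn_exp_mul_Ioi (a := -a) (by linarith) 0
  have h3 : (fun t : ℝ => Real.exp (-(t * a))) = fun t => Real.exp (-a * t) := by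
    funext t; congr 1; ring
  rw [← ofReal_integral_eq_lintegral_ofReal (by rw [h3]; exact h2)
    (Eventually.of_forall fun _ => (Real.exp_pos _).le), h3, h1]
  simp

/-- The expectation of a ratio as a mixture of exponentials, `X / Y = ∫ X exp (-tY) dt`. -/
lemma lintegral_div_eq_lintegral_exp {Ω : Type*} [MeasurableSpace Ω] (P : Measure Ω) [SFinite P]
    {X Y : Ω → ℝ} (hX : Measurable X) (hY : Measurable Y) (hX0 : ∀ ω, 0 ≤ X ω)
    (hY0 : ∀ᵐ ω ∂P, 0 < Y ω) :
    ∫⁻ ω, ENNReal.ofReal (X ω / Y ω) ∂P =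
      ∫⁻ t in Ioi (0 : ℝ), ∫⁻ ω, ENNReal.ofReal (X ω * Real.exp (-(t * Y ω))) ∂P := by
  rw [lintegral_lintegral_swap (by fun_prop)]
  refine lintegral_congr_ae (hY0.mono fun ω hω => ?_)
  simp only [ENNReal.ofReal_mul (hX0 ω)]
  rw [lintegral_const_mul _ (by fun_prop), lintegral_exp_neg_mul_Ioi hω,
    ← ENNReal.ofReal_mul (hX0 ω), div_eq_mul_inv]

/-- Exponential tilting of the standard Gaussian by `exp (-a z²)` gives, up to a factor, the
centred Gaussian of variance `1 / (1 + 2a)`. -/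
lemma lintegral_gaussianReal_mul_exp {a : ℝ} (ha : 0 ≤ a) {f : ℝ → ℝ≥0∞} (hf : Measurable f) :
    ∫⁻ z, f z * ENNReal.ofReal (Real.exp (-(a * z ^ 2))) ∂(gaussianReal 0 1) =
      ENNReal.ofReal ((1 + 2 * a) ^ (-(1 / 2) : ℝ)) *
        ∫⁻ z, f z ∂(gaussianReal 0 (1 + 2 * a)⁻¹.toNNReal) := by
  have h0 : 0 < 1 + 2 * a := by linarith
  have hv : (1 + 2 * a)⁻¹.toNNReal ≠ 0 := by simpa using h0
  rw [gaussianReal_of_var_ne_zero _ one_ne_zero, gaussianReal_of_var_ne_zero _ hv,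
    lintegral_withDensity_eq_lintegral_mul _ (measurable_gaussianPDF _ _) (by fun_prop),
    lintegral_withDensity_eq_lintegral_mul _ (measurable_gaussianPDF _ _) hf,
    ← lintegral_const_mul _ (by fun_prop)]
  refine lintegral_congr fun z => ?_
  have key : gaussianPDFReal 0 1 z * Real.exp (-(a * z ^ 2)) =
      (1 + 2 * a) ^ (-(1 / 2) : ℝ) * gaussianPDFReal 0 (1 + 2 * a)⁻¹.toNNReal z := by
    have hs : √(1 + 2 * a) ≠ 0 := (Real.sqrt_pos.2 h0).ne'
    rw [gaussianPDFReal, gaussianPDFReal, Real.coe_toNNReal _ (by positivity),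
      Real.rpow_neg h0.le, ← Real.sqrt_eq_rpow, mul_assoc, ← Real.exp_add, NNReal.coe_one,
      Real.sqrt_mul (show (0 : ℝ) ≤ 2 * Real.pi by positivity),
      Real.sqrt_mul (show (0 : ℝ) ≤ 2 * Real.pi by positivity), Real.sqrt_inv, Real.sqrt_one]
    rw [show -(z - 0) ^ 2 / (2 * 1) + -(a * z ^ 2) = -(z - 0) ^ 2 / (2 * (1 + 2 * a)⁻¹) by
      field_simp; ring]
    field_simp
  simp only [Pi.mul_apply, gaussianPDF]
  rw [mul_left_comm, ← ENNReal.ofReal_mul (gaussianPDFReal_nonneg _ _ _), key,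
    ENNReal.ofReal_mul (by positivity)]
  ring

lemma lintegral_gaussianReal_exp {a : ℝ} (ha : 0 ≤ a) :
    ∫⁻ z, ENNReal.ofReal (Real.exp (-(a * z ^ 2))) ∂(gaussianReal 0 1) =
      ENNReal.ofReal ((1 + 2 * a) ^ (-(1 / 2) : ℝ)) := by
  simpa using lintegral_gaussianReal_mul_exp ha (f := fun _ => 1) measurable_const

lemma lintegral_gaussianReal_sq_mul_exp {a : ℝ} (ha : 0 ≤ a) :
    ∫⁻ z, ENNReal.ofReal (z ^ 2 * Real.exp (-(a * z ^ 2))) ∂(gaussianReal 0 1) =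
      ENNReal.ofReal ((1 + 2 * a) ^ (-(3 / 2) : ℝ)) := by
  have h0 : 0 < 1 + 2 * a := by linarith
  simp only [ENNReal.ofReal_mul (sq_nonneg _)]
  rw [lintegral_gaussianReal_mul_exp ha (by fun_prop)]
  have hL : MemLp id 2 (gaussianReal 0 (1 + 2 * a)⁻¹.toNNReal) := memLp_id_gaussianReal 2
  have hvar := variance_id_gaussianReal (μ := 0) (v := (1 + 2 * a)⁻¹.toNNReal)
  rw [variance_eq_integral measurable_id.aemeasurable] at hvar
  simp only [id, integral_id_gaussianReal, sub_zero] at hvar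
  rw [← ofReal_integral_eq_lintegral_ofReal (f := fun z : ℝ => z ^ 2) hL.integrable_sq
    (Eventually.of_forall fun _ => sq_nonneg _), hvar, Real.coe_toNNReal _ (by positivity),
    ← ENNReal.ofReal_mul (by positivity),
    ← Real.rpow_neg_one, ← Real.rpow_add h0]
  norm_num

lemma ae_gaussianReal_ne_zero : ∀ᵐ z ∂(gaussianReal 0 1), z ≠ 0 := by
  have := nullSingletonClass_gaussianReal (μ := 0) (v := 1) one_ne_zero
  simp [ae_iff]

/-- For `Z ∼ N(0, 1)`: `E[Z² / (c + d Z²)]` as a one-dimensional integral. -/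
lemma lintegral_gaussianReal_ratio {c d : ℝ} (hc : 0 ≤ c) (hd : 0 ≤ d) (hcd : 0 < c + d) :
    ∫⁻ z, ENNReal.ofReal (z ^ 2 / (c + d * z ^ 2)) ∂(gaussianReal 0 1) =
      ∫⁻ t in Ioi (0 : ℝ), ENNReal.ofReal
        (Real.exp (-(t * c)) * (1 + 2 * t * d) ^ (-(3 / 2) : ℝ)) := by
  rw [lintegral_div_eq_lintegral_exp _ (by fun_prop) (by fun_prop) (fun _ => sq_nonneg _)]
  · refine setLIntegral_congr_fun measurableSet_Ioi fun t ht => ?_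
    have ht0 : 0 < t := ht
    have h := lintegral_gaussianReal_sq_mul_exp (a := t * d) (by positivity)
    rw [ENNReal.ofReal_mul (Real.exp_pos _).le, mul_assoc 2 t d, ← h,
      ← lintegral_const_mul _ (by fun_prop)]
    refine lintegral_congr fun z => ?_
    rw [← ENNReal.ofReal_mul (Real.exp_pos _).le, mul_left_comm, ← Real.exp_add]
    congr 3
    ring
  · filter_upwards [ae_gaussianReal_ne_zero] with z hz
    rcases hc.lt_or_eq with h | h
    · positivity
    · have : 0 < d := by linarith
      positivity

/-- The case `c = 0` of the preceding formula, where the ratio is constant. -/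
lemma lintegral_one_add_rpow {d : ℝ} (hd : 0 < d) :
    ∫⁻ t in Ioi (0 : ℝ), ENNReal.ofReal ((1 + 2 * t * d) ^ (-(3 / 2) : ℝ)) =
      ENNReal.ofReal d⁻¹ := by
  have h := lintegral_gaussianReal_ratio le_rfl hd.le (by simpa using hd)
  simp only [mul_zero, neg_zero, Real.exp_zero, one_mul, zero_add] at h
  rw [← h]
  trans ∫⁻ _, ENNReal.ofReal d⁻¹ ∂(gaussianReal 0 1)
  · refine lintegral_congr_ae ?_
    filter_upwards [ae_gaussianReal_ne_zero] with z hz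
    congr 1
    field_simp
  · simp

/-! ### The factor interpolating between `1` and the exponential -/

/-- `k ↦ (1 + x / k) ^ k` is monotone (Bernoulli's inequality), including the value `1` at
`k = 0`. -/
lemma one_add_div_rpow_le {k k' x x' : ℝ} (hk : 0 ≤ k) (hkk : k ≤ k') (hx : 0 ≤ x)
    (hxx : x ≤ x') : (1 + x / k) ^ k ≤ (1 + x' / k') ^ k' := by
  have hk' : 0 ≤ k' := hk.trans hkk
  have hx' : 0 ≤ x' := hx.trans hxx
  have h1 : 1 ≤ 1 + x' / k' := le_add_of_nonneg_right (div_nonneg hx' hk')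
  rcases hk.eq_or_lt with rfl | hk0
  · rw [Real.rpow_zero]
    exact Real.one_le_rpow h1 hk'
  have hk0' : 0 < k' := hk0.trans_le hkk
  have hp : 1 ≤ k' / k := (one_le_div hk0).2 hkk
  have hb := one_add_mul_self_le_rpow_one_add (s := x' / k')
    (le_trans (by norm_num) (div_nonneg hx' hk')) hp
  have h2 : k' / k * (x' / k') = x' / k := by field_simp
  rw [h2] at hb
  have h3 : 1 + x / k ≤ (1 + x' / k') ^ (k' / k) :=
    le_trans (by gcongr) hb
  calc (1 + x / k) ^ k ≤ ((1 + x' / k') ^ (k' / k)) ^ k :=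
        Real.rpow_le_rpow (by positivity) h3 hk
    _ = (1 + x' / k') ^ k' := by
        rw [← Real.rpow_mul (by positivity), div_mul_cancel₀ _ hk0.ne']

lemma rpow_neg_div_two_eq {b k : ℝ} (hb : 0 ≤ b) :
    b ^ (-k / 2) = (b ^ k) ^ (-(1 / 2) : ℝ) := by
  rw [← Real.rpow_mul hb]
  congr 1
  ring

lemma one_add_div_rpow_neg_le {k k' x x' : ℝ} (hk : 0 ≤ k) (hkk : k ≤ k') (hx : 0 ≤ x)
    (hxx : x ≤ x') : (1 + x' / k') ^ (-k' / 2) ≤ (1 + x / k) ^ (-k / 2) := by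
  have hb : 0 < 1 + x / k := by positivity
  have hb' : 0 < 1 + x' / k' := add_pos_of_pos_of_nonneg one_pos
    (div_nonneg (hx.trans hxx) (hk.trans hkk))
  rw [rpow_neg_div_two_eq hb.le, rpow_neg_div_two_eq hb'.le]
  exact Real.rpow_le_rpow_of_nonpos (Real.rpow_pos_of_pos hb _)
    (one_add_div_rpow_le hk hkk hx hxx) (by norm_num)

lemma tendsto_one_add_div_rpow_neg {x : ℝ} (hx : 0 ≤ x) :
    Tendsto (fun k : ℝ => (1 + x / k) ^ (-k / 2)) atTop (𝓝 (Real.exp (-(x / 2)))) := by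
  have h := (Real.tendsto_one_add_div_rpow_exp x).rpow_const (p := -(1 / 2))
    (Or.inl (Real.exp_pos x).ne')
  rw [← Real.exp_mul, show x * -(1 / 2) = -(x / 2) by ring] at h
  refine h.congr' ?_
  filter_upwards [eventually_ge_atTop 0] with k hk
  rw [rpow_neg_div_two_eq (by positivity)]

/-- The exponential is the limit of a decreasing family, hence a lower bound. -/
lemma exp_neg_le_one_add_div_rpow {k x : ℝ} (hk : 0 ≤ k) (hx : 0 ≤ x) :
    Real.exp (-(x / 2)) ≤ (1 + x / k) ^ (-k / 2) := by
  refine le_of_tendsto (tendsto_one_add_div_rpow_neg hx) ?_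
  filter_upwards [eventually_ge_atTop k] with k' hk'
  exact one_add_div_rpow_neg_le hk hk' hx le_rfl

lemma one_add_div_rpow_neg_le_one {k x : ℝ} (hk : 0 ≤ k) (hx : 0 ≤ x) :
    (1 + x / k) ^ (-k / 2) ≤ 1 :=
  Real.rpow_le_one_of_one_le_of_nonpos (le_add_of_nonneg_right (div_nonneg hx hk)) (by linarith)

/-! ### Existence of minimizers -/

/-- By Fatou's lemma an integral depending continuously on a parameter is lower semicontinuous, so
it attains its minimum over a compact interval even where it is infinite. -/
lemma exists_isMinOn_lintegral {F : ℝ → ℝ → ℝ≥0∞} (hF : ∀ l, Measurable (F l))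
    (hc : ∀ t ∈ Ioi (0 : ℝ), ContinuousOn (fun l => F l t) (Icc 0 1)) :
    ∃ l ∈ Icc (0 : ℝ) 1, IsMinOn (fun l => ∫⁻ t in Ioi (0 : ℝ), F l t) (Icc 0 1) l := by
  refine LowerSemicontinuousOn.exists_isMinOn (by simp) isCompact_Icc ?_
  rw [lowerSemicontinuousOn_iff_le_liminf]
  intro l hl
  refine le_trans ?_ (lintegral_liminf_le hF)
  refine setLIntegral_mono' measurableSet_Ioi fun t ht => ?_
  have := mem_closure_iff_nhdsWithin_neBot.1 (subset_closure hl)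
  exact ((hc t ht) l hl).liminf_eq.ge

/-- If the value at `0` is at least the finite value at `1`, the minimum over `[0, 1]` is attained
at a positive point. -/
lemma exists_pos_min {f : ℝ → ℝ≥0∞} (hmin : ∃ l ∈ Icc (0 : ℝ) 1, IsMinOn f (Icc 0 1) l)
    (h01 : f 1 ≤ f 0) (h1 : f 1 ≠ ⊤) :
    ∃ l, 0 < l ∧ l ≤ 1 ∧ f l = ENNReal.ofReal (⨅ l ∈ Icc (0 : ℝ) 1, f l).toReal ∧
      ∀ l' ∈ Icc (0 : ℝ) 1, f l ≤ f l' := by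
  obtain ⟨l, hl, hm⟩ : ∃ l, (0 < l ∧ l ≤ 1) ∧ ∀ l' ∈ Icc (0 : ℝ) 1, f l ≤ f l' := by
    obtain ⟨l, hl, hm⟩ := hmin
    rcases hl.1.eq_or_lt with rfl | h
    · exact ⟨1, by simp, fun l' hl' => h01.trans (hm hl')⟩
    · exact ⟨l, ⟨h, hl.2⟩, fun l' hl' => hm hl'⟩
  have heq : ⨅ l ∈ Icc (0 : ℝ) 1, f l = f l :=
    le_antisymm (iInf₂_le l ⟨hl.1.le, hl.2⟩) (le_iInf₂ hm)
  refine ⟨l, hl.1, hl.2, ?_, hm⟩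
  rw [heq, ENNReal.ofReal_toReal (ne_top_of_le_ne_top h1 (hm 1 (by simp)))]

/-! ### The constants `β_{n,m}` and `β_{∞,m}` -/

lemma natCast_mul_sub_one_nonneg {n m : ℕ} (hn : 1 ≤ n) (hm : 1 ≤ m) : 0 ≤ (n : ℝ) * m - 1 := by
  have h : 1 ≤ n * m := Nat.mul_pos hn hm
  have : (1 : ℝ) ≤ (n : ℝ) * m := by exact_mod_cast h
  linarith

/-- `betaIntegral` written with the first base in the form `1 + x / k`. -/
lemma betaIntegral_eq (n m : ℕ) (l : ℝ) : betaIntegral n m l =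
    ∫⁻ t in Ioi (0 : ℝ), ENNReal.ofReal
    ((1 + 2 * t * m * (1 - l) / ((n : ℝ) * m - 1)) ^ (-((n : ℝ) * m - 1) / 2) *
      (1 + 2 * t * m * l) ^ (-(3 / 2) : ℝ)) := by
  simp only [betaIntegral, mul_div_assoc]

lemma betaIntegral_one {n m : ℕ} (hm : 1 ≤ m) :
    betaIntegral n m 1 = ENNReal.ofReal (m : ℝ)⁻¹ := by
  have h := lintegral_one_add_rpow (d := m) (by exact_mod_cast hm)
  simpa [betaIntegral] using h

lemma betaInfIntegral_eq_gaussian {m : ℕ} (hm : 1 ≤ m) {l : ℝ} (hl : l ∈ Icc (0 : ℝ) 1) :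
    betaInfIntegral m l =
      ∫⁻ z, ENNReal.ofReal (z ^ 2 / (m * (1 - l) + m * l * z ^ 2)) ∂(gaussianReal 0 1) := by
  have hm0 : (0 : ℝ) < m := by exact_mod_cast hm
  rw [lintegral_gaussianReal_ratio (mul_nonneg hm0.le (by linarith [hl.2]))
    (mul_nonneg hm0.le hl.1) (by ring_nf; exact hm0)]
  simp only [betaInfIntegral, mul_assoc]

lemma betaInfIntegral_one {m : ℕ} (hm : 1 ≤ m) :
    betaInfIntegral m 1 = ENNReal.ofReal (m : ℝ)⁻¹ := by
  have h := lintegral_one_add_rpow (d := m) (by exact_mod_cast hm)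
  simpa [betaInfIntegral] using h

lemma betaInfIntegral_zero {m : ℕ} (hm : 1 ≤ m) :
    betaInfIntegral m 0 = ENNReal.ofReal (m : ℝ)⁻¹ := by
  have h := lintegral_exp_neg_mul_Ioi (a := m) (by exact_mod_cast hm)
  simpa [betaInfIntegral] using h

lemma betaInfIntegral_le_betaIntegral {n m : ℕ} (hn : 1 ≤ n) (hm : 1 ≤ m) {l : ℝ}
    (hl : l ∈ Icc (0 : ℝ) 1) : betaInfIntegral m l ≤ betaIntegral n m l := by
  rw [betaIntegral_eq]
  refine setLIntegral_mono' measurableSet_Ioi fun t ht => ENNReal.ofReal_le_ofReal ?_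
  have ht0 : 0 < t := ht
  have hl0 := hl.1
  have hl1 : 0 ≤ 1 - l := sub_nonneg.2 hl.2
  refine mul_le_mul_of_nonneg_right ?_ (by positivity)
  have h := exp_neg_le_one_add_div_rpow (natCast_mul_sub_one_nonneg hn hm)
    (x := 2 * t * m * (1 - l)) (by positivity)
  rwa [show 2 * t * m * (1 - l) / 2 = t * m * (1 - l) by ring] at h

lemma measurable_betaIntegrand (n m : ℕ) (l : ℝ) : Measurable fun t : ℝ => ENNReal.ofReal
    ((1 + 2 * t * m * (1 - l) / ((n : ℝ) * m - 1)) ^ (-((n : ℝ) * m - 1) / 2) *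
      (1 + 2 * t * m * l) ^ (-(3 / 2) : ℝ)) := by
  fun_prop

lemma exists_pos_min_betaIntegral {n m : ℕ} (hn : 1 ≤ n) (hm : 1 ≤ m) :
    ∃ l, 0 < l ∧ l ≤ 1 ∧ betaIntegral n m l = ENNReal.ofReal (betaConst n m) ∧
      ∀ l' ∈ Icc (0 : ℝ) 1, betaIntegral n m l ≤ betaIntegral n m l' := by
  refine exists_pos_min ?_ ?_ (by simp [betaIntegral_one hm])
  · simp only [funext (betaIntegral_eq n m)]
    refine exists_isMinOn_lintegral (measurable_betaIntegrand n m) fun t ht => ?_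
    have ht0 : 0 < t := ht
    have hk := natCast_mul_sub_one_nonneg hn hm
    refine ENNReal.continuous_ofReal.comp_continuousOn (ContinuousOn.mul ?_ ?_)
    · refine ContinuousOn.rpow_const (by fun_prop) fun l hl => Or.inl ?_
      have hl1 : 0 ≤ 1 - l := sub_nonneg.2 hl.2
      positivity
    · refine ContinuousOn.rpow_const (by fun_prop) fun l hl => Or.inl ?_
      have hl0 := hl.1
      positivity
  · rw [betaIntegral_one hm, ← betaInfIntegral_zero hm]
    exact betaInfIntegral_le_betaIntegral hn hm (by simp)

lemma exists_pos_min_betaInfIntegral {m : ℕ} (hm : 1 ≤ m) :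
    ∃ l, 0 < l ∧ l ≤ 1 ∧ betaInfIntegral m l = ENNReal.ofReal (betaConstInf m) ∧
      ∀ l' ∈ Icc (0 : ℝ) 1, betaInfIntegral m l ≤ betaInfIntegral m l' := by
  refine exists_pos_min ?_ ?_ (by simp [betaInfIntegral_one hm])
  · unfold betaInfIntegral
    refine exists_isMinOn_lintegral (fun l => by fun_prop) fun t ht => ?_
    have ht0 : 0 < t := ht
    refine ENNReal.continuous_ofReal.comp_continuousOn (ContinuousOn.mul (by fun_prop) ?_)
    refine ContinuousOn.rpow_const (by fun_prop) fun l hl => Or.inl ?_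
    have hl0 := hl.1
    positivity
  · rw [betaInfIntegral_one hm, betaInfIntegral_zero hm]

lemma ofReal_betaConst_le {n m : ℕ} (hn : 1 ≤ n) (hm : 1 ≤ m) {l : ℝ}
    (hl : l ∈ Icc (0 : ℝ) 1) : ENNReal.ofReal (betaConst n m) ≤ betaIntegral n m l := by
  obtain ⟨l₀, -, -, h, hmin⟩ := exists_pos_min_betaIntegral hn hm
  exact h ▸ hmin l hl

lemma betaConst_nonneg (n m : ℕ) : 0 ≤ betaConst n m := ENNReal.toReal_nonneg

/-- The integrand decreases both when `nm` and when `m` grows. -/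
lemma betaConst_anti {n m n' m' : ℕ} (hn : 1 ≤ n) (hm : 1 ≤ m) (hnn : n ≤ n') (hmm : m ≤ m') :
    betaConst n' m' ≤ betaConst n m := by
  obtain ⟨l, hl0, hl1, h, -⟩ := exists_pos_min_betaIntegral hn hm
  have hle : betaIntegral n' m' l ≤ betaIntegral n m l := by
    rw [betaIntegral_eq, betaIntegral_eq]
    refine setLIntegral_mono' measurableSet_Ioi fun t ht => ENNReal.ofReal_le_ofReal ?_
    have ht0 : 0 < t := ht
    have hl1' : 0 ≤ 1 - l := sub_nonneg.2 hl1
    have hmm' : (m : ℝ) ≤ m' := by exact_mod_cast hmm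
    have hnn' : (n : ℝ) ≤ n' := by exact_mod_cast hnn
    have hk := natCast_mul_sub_one_nonneg hn hm
    have hk' := natCast_mul_sub_one_nonneg (hn.trans hnn) (hm.trans hmm)
    refine mul_le_mul (one_add_div_rpow_neg_le hk (by gcongr) (by positivity) (by gcongr))
      (Real.rpow_le_rpow_of_nonpos (by positivity) (by gcongr) (by norm_num))
      (by positivity) (by positivity)
  have := ((ofReal_betaConst_le (hn.trans hnn) (hm.trans hmm) ⟨hl0.le, hl1⟩).trans hle).trans h.le
  exact (ENNReal.ofReal_le_ofReal_iff (betaConst_nonneg n m)).1 this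

lemma tendsto_betaIntegral {m : ℕ} (hm : 1 ≤ m) {l : ℝ} (hl0 : 0 < l) (hl1 : l ≤ 1) :
    Tendsto (fun n : ℕ => betaIntegral n m l) atTop (𝓝 (betaInfIntegral m l)) := by
  have hm0 : (0 : ℝ) < m := by exact_mod_cast hm
  have hl1' : 0 ≤ 1 - l := sub_nonneg.2 hl1
  -- shifting the index keeps `nm - 1 ≥ 0`
  rw [← tendsto_add_atTop_iff_nat 1]
  simp only [betaIntegral_eq, betaInfIntegral]
  refine tendsto_lintegral_of_dominated_convergence
    (fun t => ENNReal.ofReal ((1 + 2 * t * (m * l)) ^ (-(3 / 2) : ℝ)))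
    (fun n => measurable_betaIntegrand _ m l) (fun n => ?_) ?_ ?_
  · refine (ae_restrict_iff' measurableSet_Ioi).2 (Eventually.of_forall fun t ht => ?_)
    have ht0 : 0 < t := ht
    refine ENNReal.ofReal_le_ofReal ?_
    rw [← mul_assoc (2 * t)]
    exact mul_le_of_le_one_left (by positivity) (one_add_div_rpow_neg_le_one
      (natCast_mul_sub_one_nonneg (Nat.le_add_left 1 n) hm) (by positivity))
  · rw [lintegral_one_add_rpow (by positivity)]
    exact ENNReal.ofReal_ne_top
  · refine (ae_restrict_iff' measurableSet_Ioi).2 (Eventually.of_forall fun t ht => ?_)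
    have ht0 : 0 < t := ht
    refine (ENNReal.continuous_ofReal.tendsto _).comp (Tendsto.mul_const _ ?_)
    have hk : Tendsto (fun n : ℕ => ((n + 1 : ℕ) : ℝ) * m - 1) atTop atTop :=
      tendsto_atTop_add_const_right _ _
        (((tendsto_natCast_atTop_atTop (R := ℝ)).comp (tendsto_add_atTop_nat 1)).atTop_mul_const
          hm0)
    have h := (tendsto_one_add_div_rpow_neg
      (x := 2 * t * m * (1 - l)) (by positivity)).comp hk
    rwa [show 2 * t * m * (1 - l) / 2 = t * m * (1 - l) by ring] at h

lemma tendsto_betaConst {m : ℕ} (hm : 1 ≤ m) :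
    Tendsto (fun n : ℕ => betaConst n m) atTop (𝓝 (betaConstInf m)) := by
  obtain ⟨l, hl0, hl1, h, hmin⟩ := exists_pos_min_betaInfIntegral hm
  have hlim : Tendsto (fun n : ℕ => (betaIntegral n m l).toReal) atTop (𝓝 (betaConstInf m)) := by
    have := (ENNReal.tendsto_toReal (h ▸ ENNReal.ofReal_ne_top)).comp
      (tendsto_betaIntegral hm hl0 hl1)
    rwa [h, ENNReal.toReal_ofReal (show 0 ≤ betaConstInf m from ENNReal.toReal_nonneg)] at this
  have hfin : ∀ᶠ n : ℕ in atTop, betaIntegral n m l ≠ ⊤ :=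
    (tendsto_betaIntegral hm hl0 hl1).eventually_ne (h ▸ ENNReal.ofReal_ne_top)
  refine tendsto_of_tendsto_of_tendsto_of_le_of_le' tendsto_const_nhds hlim ?_ ?_
  · filter_upwards [eventually_ge_atTop 1] with n hn
    obtain ⟨l', hl0', hl1', h', -⟩ := exists_pos_min_betaIntegral hn hm
    refine (ENNReal.ofReal_le_ofReal_iff (betaConst_nonneg n m)).1 ?_
    rw [← h, ← h']
    exact (hmin l' ⟨hl0'.le, hl1'⟩).trans
      (betaInfIntegral_le_betaIntegral hn hm ⟨hl0'.le, hl1'⟩)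
  · filter_upwards [eventually_ge_atTop 1, hfin] with n hn hf
    exact (ENNReal.ofReal_le_iff_le_toReal hf).1 (ofReal_betaConst_le hn hm ⟨hl0.le, hl1⟩)

/-- The chi-squared form of `β_{∞,m}`. -/
lemma lintegral_chiSquaredOne {m : ℕ} (hm : 1 ≤ m) {l : ℝ} (hl : l ∈ Icc (0 : ℝ) 1) :
    ∫⁻ x, ENNReal.ofReal (x / (m * (1 - l) + m * l * x)) ∂chiSquaredOne =
      betaInfIntegral m l := by
  rw [betaInfIntegral_eq_gaussian hm hl, chiSquaredOne, lintegral_map (by fun_prop) (by fun_prop)]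

lemma ae_chiSquaredOne_nonneg {m : ℕ} {l : ℝ} (hl : l ∈ Icc (0 : ℝ) 1) :
    ∀ᵐ x ∂chiSquaredOne, 0 ≤ x / (m * (1 - l) + m * l * x) := by
  have hl0 := hl.1
  have hl1 : 0 ≤ 1 - l := sub_nonneg.2 hl.2
  refine (ae_map_iff (by fun_prop) (measurableSet_le (by fun_prop) (by fun_prop))).2
    (Eventually.of_forall fun z => ?_)
  positivity

lemma betaInfIntegral_ne_top {m : ℕ} (hm : 1 ≤ m) {l : ℝ} (hl : l ∈ Icc (0 : ℝ) 1) :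
    betaInfIntegral m l ≠ ⊤ := by
  have hm0 : (0 : ℝ) < m := by exact_mod_cast hm
  rcases hl.1.eq_or_lt with rfl | h0
  · simp [betaInfIntegral_zero hm]
  · have hfin : ∫⁻ t in Ioi (0 : ℝ),
        ENNReal.ofReal ((1 + 2 * t * (m * l)) ^ (-(3 / 2) : ℝ)) ≠ ⊤ := by
      rw [lintegral_one_add_rpow (by positivity)]
      exact ENNReal.ofReal_ne_top
    refine ne_top_of_le_ne_top hfin (setLIntegral_mono' measurableSet_Ioi fun t ht => ?_)
    have ht0 : 0 < t := ht
    have hl1 : 0 ≤ 1 - l := sub_nonneg.2 hl.2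
    refine ENNReal.ofReal_le_ofReal ?_
    rw [← mul_assoc (2 * t)]
    exact mul_le_of_le_one_left (by positivity)
      (Real.exp_le_one_iff.2 (neg_nonpos.2 (by positivity)))

lemma integrable_chiSquaredOne {m : ℕ} (hm : 1 ≤ m) {l : ℝ} (hl : l ∈ Icc (0 : ℝ) 1) :
    Integrable (fun x : ℝ => x / (m * (1 - l) + m * l * x)) chiSquaredOne := by
  refine ⟨Measurable.aestronglyMeasurable (by fun_prop), ?_⟩
  rw [hasFiniteIntegral_iff_ofReal (ae_chiSquaredOne_nonneg hl), lintegral_chiSquaredOne hm hl]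
  exact (betaInfIntegral_ne_top hm hl).lt_top

lemma integral_chiSquaredOne {m : ℕ} (hm : 1 ≤ m) {l : ℝ} (hl : l ∈ Icc (0 : ℝ) 1) :
    ∫ x, x / (m * (1 - l) + m * l * x) ∂chiSquaredOne = (betaInfIntegral m l).toReal := by
  rw [integral_eq_lintegral_of_nonneg_ae (ae_chiSquaredOne_nonneg hl)
    (integrable_chiSquaredOne hm hl).1, lintegral_chiSquaredOne hm hl]

/-! ### Ratios of quadratic forms in independent standard Gaussians -/

/-- The inequality between the geometric and the arithmetic mean, in the form in which it bounds a
product of square roots by that of equal factors. -/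
lemma one_add_div_rpow_le_prod {κ : Type*} (s : Finset κ) {y : κ → ℝ} (hy : ∀ i, 0 ≤ y i) :
    (1 + (∑ i ∈ s, y i) / (s.card : ℝ)) ^ (-(s.card : ℝ) / 2) ≤
      ∏ i ∈ s, (1 + y i) ^ (-(1 / 2) : ℝ) := by
  have hp (i) : 0 < 1 + y i := by linarith [hy i]
  rcases s.eq_empty_or_nonempty with rfl | hs
  · simp
  have hk : 0 < (s.card : ℝ) := by exact_mod_cast hs.card_pos
  have h := Real.geom_mean_le_arith_mean s (fun _ => 1) (fun i => 1 + y i)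
    (fun _ _ => zero_le_one) (by simpa using hs) (fun i _ => (hp i).le)
  simp only [Real.rpow_one, Finset.sum_const, nsmul_eq_mul, mul_one, one_mul,
    Finset.sum_add_distrib] at h
  rw [add_div, div_self hk.ne'] at h
  have hP : 0 < ∏ i ∈ s, (1 + y i) := Finset.prod_pos fun i _ => hp i
  have hsum : 0 ≤ ∑ i ∈ s, y i := Finset.sum_nonneg fun i _ => hy i
  have h2 : ∏ i ∈ s, (1 + y i) ≤ (1 + (∑ i ∈ s, y i) / (s.card : ℝ)) ^ (s.card : ℝ) := by
    have := Real.rpow_le_rpow (Real.rpow_nonneg hP.le _) h hk.le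
    rwa [← Real.rpow_mul hP.le, inv_mul_cancel₀ hk.ne', Real.rpow_one] at this
  rw [rpow_neg_div_two_eq (by positivity), Real.finsetProd_rpow _ _ (fun i _ => (hp i).le)]
  exact Real.rpow_le_rpow_of_nonpos hP h2 (by norm_num)

section Ratio

variable {ι : Type*} [Fintype ι]

lemma ae_sum_mul_sq_pos {a : ι → ℝ} (ha : ∀ i, 0 ≤ a i) {i : ι} (hi : 0 < a i) :
    ∀ᵐ z ∂(Measure.pi fun _ : ι => gaussianReal 0 1), 0 < ∑ j, a j * z j ^ 2 := by
  filter_upwards [(Measure.quasiMeasurePreserving_eval (μ := fun _ : ι => gaussianReal 0 1)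
    i).ae ae_gaussianReal_ne_zero] with z hz
  refine Finset.sum_pos' (fun j _ => mul_nonneg (ha j) (sq_nonneg _))
    ⟨i, Finset.mem_univ i, mul_pos hi (by positivity)⟩

lemma abs_mul_mul_div_le {a : ι → ℝ} (ha : ∀ i, 0 ≤ a i) (i j : ι) (z : ι → ℝ) :
    |(√(a i) * z i) * (√(a j) * z j) / ∑ k, a k * z k ^ 2| ≤ 1 := by
  have hQ : 0 ≤ ∑ k, a k * z k ^ 2 := Finset.sum_nonneg fun k _ => mul_nonneg (ha k) (sq_nonneg _)
  have h (k) : |√(a k) * z k| ≤ √(∑ k, a k * z k ^ 2) := by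
    refine Real.abs_le_sqrt ?_
    rw [mul_pow, Real.sq_sqrt (ha k)]
    exact Finset.single_le_sum (f := fun k => a k * z k ^ 2)
      (fun k _ => mul_nonneg (ha k) (sq_nonneg _)) (Finset.mem_univ k)
  rw [abs_div, abs_of_nonneg hQ, abs_mul]
  refine div_le_one_of_le₀ ?_ hQ
  calc _ ≤ _ := mul_le_mul (h i) (h j) (abs_nonneg _) (Real.sqrt_nonneg _)
    _ = _ := Real.mul_self_sqrt hQ

lemma integrable_mul_mul_div {a : ι → ℝ} (ha : ∀ i, 0 ≤ a i) (i j : ι) :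
    Integrable (fun z : ι → ℝ => (√(a i) * z i) * (√(a j) * z j) / ∑ k, a k * z k ^ 2)
      (Measure.pi fun _ : ι => gaussianReal 0 1) :=
  Integrable.of_bound (Measurable.aestronglyMeasurable (by fun_prop)) 1
    (Eventually.of_forall fun z => abs_mul_mul_div_le ha i j z)

lemma ofReal_integral_sq_div {a : ι → ℝ} (ha : ∀ i, 0 ≤ a i) {i : ι} (hi : 0 < a i) :
    ENNReal.ofReal (∫ z : ι → ℝ, z i ^ 2 / ∑ k, a k * z k ^ 2
      ∂(Measure.pi fun _ : ι => gaussianReal 0 1)) =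
    ∫⁻ z : ι → ℝ, ENNReal.ofReal (z i ^ 2 / ∑ k, a k * z k ^ 2)
      ∂(Measure.pi fun _ : ι => gaussianReal 0 1) := by
  refine ofReal_integral_eq_lintegral_ofReal ?_ (Eventually.of_forall fun z => div_nonneg
    (sq_nonneg _) (Finset.sum_nonneg fun k _ => mul_nonneg (ha k) (sq_nonneg _)))
  refine ((integrable_mul_mul_div ha i i).const_mul (a i)⁻¹).congr
    (Eventually.of_forall fun z => ?_)
  have hs := Real.mul_self_sqrt hi.le
  simp only
  rw [mul_mul_mul_comm, hs]
  field_simp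

variable [DecidableEq ι]

/-- The expectation of `Z_i² / ∑ j, a_j Z_j²` for independent standard Gaussians: after writing the
ratio as a mixture of exponentials, the expectation factors over the coordinates. -/
lemma lintegral_pi_ratio {a : ι → ℝ} (ha : ∀ i, 0 ≤ a i) {i : ι} (hi : 0 < a i) :
    ∫⁻ z, ENNReal.ofReal (z i ^ 2 / ∑ j, a j * z j ^ 2)
        ∂(Measure.pi fun _ : ι => gaussianReal 0 1) =
      ∫⁻ t in Ioi (0 : ℝ), ENNReal.ofReal ((∏ j ∈ Finset.univ.erase i,
        (1 + 2 * (t * a j)) ^ (-(1 / 2) : ℝ)) * (1 + 2 * (t * a i)) ^ (-(3 / 2) : ℝ)) := by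
  rw [lintegral_div_eq_lintegral_exp _ (by fun_prop) (by fun_prop) (fun _ => sq_nonneg _)
    (ae_sum_mul_sq_pos ha hi)]
  refine setLIntegral_congr_fun measurableSet_Ioi fun t ht => ?_
  have ht0 : 0 < t := ht
  have hta (j) : 0 ≤ t * a j := mul_nonneg ht0.le (ha j)
  have hpos (j) : 0 ≤ 1 + 2 * (t * a j) := by linarith [hta j]
  set f : ι → ℝ → ℝ≥0∞ := fun j z => ENNReal.ofReal
    ((if j = i then z ^ 2 else 1) * Real.exp (-(t * a j * z ^ 2))) with hf
  have hfm (j) : Measurable (f j) := by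
    simp only [hf]
    split_ifs <;> fun_prop
  have h1 (z : ι → ℝ) : ENNReal.ofReal (z i ^ 2 * Real.exp (-(t * ∑ j, a j * z j ^ 2))) =
      ∏ j, f j (z j) := by
    rw [← ENNReal.ofReal_prod_of_nonneg (fun j _ => by split_ifs <;> positivity),
      Finset.prod_mul_distrib, ← Real.exp_sum, Finset.sum_neg_distrib, Finset.mul_sum]
    simp [mul_assoc]
  have hind : iIndepFun (fun j (z : ι → ℝ) => f j (z j))
      (Measure.pi fun _ : ι => gaussianReal 0 1) :=
    iIndepFun_pi fun j => (hfm j).aemeasurable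
  simp only [h1]
  rw [lintegral_prod_eq_prod_lintegral_of_indepFun _ _ hind
    (fun j => (hfm j).comp (measurable_pi_apply j))]
  have h2 (j) : ∫⁻ z, f j (z j) ∂(Measure.pi fun _ : ι => gaussianReal 0 1) =
      ∫⁻ x, f j x ∂(gaussianReal 0 1) :=
    (measurePreserving_eval (fun _ : ι => gaussianReal 0 1) j).lintegral_comp (hfm j)
  simp only [h2]
  rw [← Finset.prod_erase_mul _ _ (Finset.mem_univ i),
    ENNReal.ofReal_mul (Finset.prod_nonneg fun j _ => Real.rpow_nonneg (hpos j) _),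
    ENNReal.ofReal_prod_of_nonneg (fun j _ => Real.rpow_nonneg (hpos j) _)]
  congr 1
  · refine Finset.prod_congr rfl fun j hj => ?_
    rw [← lintegral_gaussianReal_exp (hta j)]
    simp [hf, Finset.ne_of_mem_erase hj]
  · rw [← lintegral_gaussianReal_sq_mul_exp (hta i)]
    simp [hf]

/-- Among nonnegative weights `a` of sum `m` with a given `a_i = m l`, equal remaining weights
minimize the expected ratio. -/
lemma betaIntegral_le_lintegral_pi_ratio {n m : ℕ} (hcard : Fintype.card ι = n * m)
    {a : ι → ℝ} (ha : ∀ i, 0 ≤ a i) (hsum : ∑ i, a i = m) {i : ι} (hi : 0 < a i) {l : ℝ}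
    (hl : a i = m * l) :
    betaIntegral n m l ≤ ∫⁻ z, ENNReal.ofReal (z i ^ 2 / ∑ j, a j * z j ^ 2)
        ∂(Measure.pi fun _ : ι => gaussianReal 0 1) := by
  rw [lintegral_pi_ratio ha hi, betaIntegral_eq]
  refine setLIntegral_mono' measurableSet_Ioi fun t ht => ENNReal.ofReal_le_ofReal ?_
  have ht0 : 0 < t := ht
  have hc : ((Finset.univ.erase i).card : ℝ) = n * m - 1 := by
    have : (Finset.univ.erase i).card + 1 = n * m := by
      rw [Finset.card_erase_add_one (Finset.mem_univ i), Finset.card_univ, hcard]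
    rw [eq_sub_iff_add_eq]
    exact_mod_cast this
  have h := one_add_div_rpow_le_prod (Finset.univ.erase i) (y := fun j => 2 * (t * a j))
    (fun j => by have := ha j; positivity)
  have hs : ∑ j ∈ Finset.univ.erase i, a j = m * (1 - l) := by
    have := Finset.add_sum_erase Finset.univ a (Finset.mem_univ i)
    rw [hsum, hl] at this
    linarith
  rw [hc, ← Finset.mul_sum, ← Finset.mul_sum, hs] at h
  have hl' : 2 * (t * a i) = 2 * t * m * l := by rw [hl]; ring
  rw [hl', show 2 * t * m * (1 - l) = 2 * (t * (m * (1 - l))) by ring]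
  refine mul_le_mul_of_nonneg_right h (Real.rpow_nonneg ?_ _)
  rw [← hl']
  have := ha i
  positivity

/-- Equal remaining weights give equality. -/
lemma betaIntegral_eq_lintegral_pi_ratio {n m : ℕ} (hcard : Fintype.card ι = n * m)
    {a : ι → ℝ} (ha : ∀ i, 0 ≤ a i) {i : ι} (hi : 0 < a i) {l : ℝ} (hl : a i = m * l)
    (hne : ∀ j, j ≠ i → a j = m * ((1 - l) / (n * m - 1))) :
    betaIntegral n m l = ∫⁻ z, ENNReal.ofReal (z i ^ 2 / ∑ j, a j * z j ^ 2)
        ∂(Measure.pi fun _ : ι => gaussianReal 0 1) := by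
  rw [lintegral_pi_ratio ha hi, betaIntegral]
  refine setLIntegral_congr_fun measurableSet_Ioi fun t ht => ?_
  have ht0 : 0 < t := ht
  have hc : ((Finset.univ.erase i).card : ℝ) = n * m - 1 := by
    have : (Finset.univ.erase i).card + 1 = n * m := by
      rw [Finset.card_erase_add_one (Finset.mem_univ i), Finset.card_univ, hcard]
    rw [eq_sub_iff_add_eq]
    exact_mod_cast this
  have hprod : ∏ j ∈ Finset.univ.erase i, (1 + 2 * (t * a j)) ^ (-(1 / 2) : ℝ) =
      (1 + 2 * t * m * ((1 - l) / (n * m - 1))) ^ (-((n : ℝ) * m - 1) / 2) := by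
    rcases (Finset.univ.erase i).eq_empty_or_nonempty with h0 | ⟨j, hj⟩
    · rw [h0] at hc ⊢
      simp [← hc]
    · have hb : 0 ≤ 1 + 2 * t * m * ((1 - l) / (n * m - 1)) := by
        have h := ha j
        rw [hne j (Finset.ne_of_mem_erase hj)] at h
        rw [mul_assoc (2 * t)]
        positivity
      rw [Finset.prod_congr rfl (fun j hj => by
          rw [hne j (Finset.ne_of_mem_erase hj), ← mul_assoc, ← mul_assoc]),
        Finset.prod_const, ← Real.rpow_natCast, ← Real.rpow_mul hb, hc]
      congr 1
      ring
  simp only [hprod, hl]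
  congr 4
  ring

/-- Mixed terms vanish, by the symmetry `z_i ↦ -z_i`. -/
lemma integral_mul_mul_div_of_ne (a : ι → ℝ) {i j : ι} (hij : i ≠ j) :
    ∫ z : ι → ℝ, (√(a i) * z i) * (√(a j) * z j) / ∑ k, a k * z k ^ 2
      ∂(Measure.pi fun _ : ι => gaussianReal 0 1) = 0 := by
  set f : ι → ℝ → ℝ := fun k x => if k = i then -x else x with hf
  have hflip : MeasurePreserving (fun (z : ι → ℝ) k => f k (z k))
      (Measure.pi fun _ : ι => gaussianReal 0 1) (Measure.pi fun _ : ι => gaussianReal 0 1) := by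
    refine measurePreserving_pi _ _ fun k => ?_
    by_cases hk : k = i
    · simp only [hf, hk, if_true]
      exact ⟨measurable_neg, by simpa using gaussianReal_map_neg (μ := 0) (v := 1)⟩
    · simp only [hf, hk, if_false]
      exact MeasurePreserving.id _
  have h := integral_map (μ := Measure.pi fun _ : ι => gaussianReal 0 1)
    hflip.measurable.aemeasurable
    (f := fun z : ι → ℝ => (√(a i) * z i) * (√(a j) * z j) / ∑ k, a k * z k ^ 2)
    (Measurable.aestronglyMeasurable (by fun_prop))
  rw [hflip.map_eq] at h
  have h2 : ∀ z : ι → ℝ, (√(a i) * f i (z i)) * (√(a j) * f j (z j)) /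
      ∑ k, a k * f k (z k) ^ 2 = -((√(a i) * z i) * (√(a j) * z j) / ∑ k, a k * z k ^ 2) := by
    intro z
    have h3 : ∀ k, f k (z k) ^ 2 = z k ^ 2 := fun k => by
      simp only [hf]; split_ifs <;> simp
    simp only [h3]
    simp only [hf, if_true, if_neg hij.symm]
    ring
  simp only [h2, integral_neg] at h
  linarith

/-- In the eigenbasis of its covariance, the normalized second moment of a Gaussian vector is
diagonal. -/
lemma integral_sq_div_eq_sum {a : ι → ℝ} (ha : ∀ i, 0 ≤ a i) (c : ι → ℝ) :
    ∫ z : ι → ℝ, (∑ i, c i * (√(a i) * z i)) ^ 2 / ∑ k, a k * z k ^ 2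
      ∂(Measure.pi fun _ : ι => gaussianReal 0 1) =
    ∑ i, c i ^ 2 * (a i * ∫ z : ι → ℝ, z i ^ 2 / ∑ k, a k * z k ^ 2
      ∂(Measure.pi fun _ : ι => gaussianReal 0 1)) := by
  have h1 (z : ι → ℝ) : (∑ i, c i * (√(a i) * z i)) ^ 2 / ∑ k, a k * z k ^ 2 =
      ∑ i, ∑ j, c i * c j * ((√(a i) * z i) * (√(a j) * z j) / ∑ k, a k * z k ^ 2) := by
    rw [sq, Finset.sum_mul_sum, Finset.sum_div]
    refine Finset.sum_congr rfl fun i _ => ?_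
    rw [Finset.sum_div]
    refine Finset.sum_congr rfl fun j _ => ?_
    ring
  simp only [h1]
  rw [integral_finsetSum _ fun i _ => integrable_finsetSum _ fun j _ =>
    (integrable_mul_mul_div ha i j).const_mul _]
  refine Finset.sum_congr rfl fun i _ => ?_
  rw [integral_finsetSum _ fun j _ => (integrable_mul_mul_div ha i j).const_mul _,
    Finset.sum_eq_single i]
  · rw [integral_const_mul, ← sq, ← integral_const_mul (a i)]
    congr 2
    funext z
    rw [mul_mul_mul_comm, Real.mul_self_sqrt (ha i)]
    ring
  · intro j _ hj
    rw [integral_const_mul, integral_mul_mul_div_of_ne a hj.symm, mul_zero]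
  · simp

end Ratio

/-! ### Gaussian vectors in an eigenbasis of their covariance -/

section Eigenbasis

variable {ι : Type*} [Fintype ι]

lemma dotProduct_mulVec_eq_sum {W : Matrix ι ι ℝ} (hW : W.IsHermitian)
    (b : OrthonormalBasis ι ℝ (EuclideanSpace ℝ ι)) {a : ι → ℝ}
    (hb : ∀ i, W.mulVec (b i) = a i • (b i : ι → ℝ)) (x : EuclideanSpace ℝ ι) :
    (x : ι → ℝ) ⬝ᵥ W.mulVec x = ∑ i, a i * inner ℝ x (b i) ^ 2 := by
  have h1 : (x : ι → ℝ) ⬝ᵥ W.mulVec x = inner ℝ x (WithLp.toLp 2 (W.mulVec x)) := by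
    rw [EuclideanSpace.inner_eq_star_dotProduct, dotProduct_comm]
    simp
  rw [h1, ← b.sum_inner_mul_inner]
  refine Finset.sum_congr rfl fun i _ => ?_
  have h2 : inner ℝ (b i) (WithLp.toLp 2 (W.mulVec x)) = a i * inner ℝ x (b i) := by
    rw [EuclideanSpace.inner_eq_star_dotProduct, EuclideanSpace.inner_eq_star_dotProduct]
    simp only [star_trivial]
    have hT : W.transpose = W := by simpa [Matrix.IsHermitian] using hW
    rw [dotProduct_comm, Matrix.dotProduct_mulVec, ← Matrix.mulVec_transpose, hT, hb,
      smul_dotProduct, smul_eq_mul]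
  rw [h2]
  ring

variable [DecidableEq ι]

/-- The Karhunen–Loève expansion: a centred Gaussian vector is `∑ √a_i Z_i b_i` for an orthonormal
eigenbasis `b` of its covariance, with eigenvalues `a`. -/
lemma multivariateGaussian_eq_map_pi {W : Matrix ι ι ℝ} (hW : W.PosSemidef)
    (b : OrthonormalBasis ι ℝ (EuclideanSpace ℝ ι)) {a : ι → ℝ} (ha : ∀ i, 0 ≤ a i)
    (hb : ∀ i, W.mulVec (b i) = a i • (b i : ι → ℝ)) :
    multivariateGaussian 0 W = (Measure.pi fun _ : ι => gaussianReal 0 1).map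
      (fun z => ∑ i, (√(a i) * z i) • b i) := by
  have hprob : IsProbabilityMeasure ((Measure.pi fun _ : ι => gaussianReal 0 1).map
      (fun z => ∑ i, (√(a i) * z i) • b i)) :=
    Measure.isProbabilityMeasure_map (Measurable.aemeasurable (by fun_prop))
  refine Measure.ext_of_charFun ?_
  ext t
  rw [charFun_multivariateGaussian hW, dotProduct_mulVec_eq_sum hW.1 b hb, charFun_apply,
    integral_map (Measurable.aemeasurable (by fun_prop))
      (Measurable.aestronglyMeasurable (by fun_prop))]
  simp_rw [sum_inner, Complex.ofReal_sum, Finset.sum_mul, Complex.exp_sum]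
  rw [integral_fintype_prod_eq_prod
    (f := fun i (x : ℝ) => Complex.exp (((inner ℝ ((√(a i) * x) • b i) t : ℝ) : ℂ) * Complex.I))]
  have h (i) : ∫ x, Complex.exp (((inner ℝ ((√(a i) * x) • b i) t : ℝ) : ℂ) * Complex.I)
      ∂(gaussianReal 0 1) = Complex.exp (-((a i * inner ℝ t (b i) ^ 2 : ℝ) : ℂ) / 2) := by
    have h1 (x : ℝ) : ((inner ℝ ((√(a i) * x) • b i) t : ℝ) : ℂ) =
        ((√(a i) * inner ℝ t (b i) : ℝ) : ℂ) * x := by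
      rw [real_inner_smul_left, real_inner_comm t, ← Complex.ofReal_mul]
      congr 1
      ring
    simp_rw [h1]
    rw [← charFun_apply_real, charFun_gaussianReal, ← Complex.ofReal_pow, mul_pow,
      Real.sq_sqrt (ha i)]
    simp [neg_div]
  simp_rw [h]
  rw [← Complex.exp_sum, ← Finset.sum_div, Finset.sum_neg_distrib, ← Complex.ofReal_sum]
  simp [neg_div]

/-- The normalized second moment of a Gaussian vector in a direction `x`, in terms of the
coordinates of `x` in an eigenbasis of the covariance. -/
lemma integral_inner_sq_div_norm_sq {W : Matrix ι ι ℝ} (hW : W.PosSemidef)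
    (b : OrthonormalBasis ι ℝ (EuclideanSpace ℝ ι)) {a : ι → ℝ} (ha : ∀ i, 0 ≤ a i)
    (hb : ∀ i, W.mulVec (b i) = a i • (b i : ι → ℝ)) (x : EuclideanSpace ℝ ι) :
    ∫ g, inner ℝ x g ^ 2 / ‖g‖ ^ 2 ∂(multivariateGaussian 0 W) =
      ∑ i, inner ℝ x (b i) ^ 2 * (a i * ∫ z : ι → ℝ, z i ^ 2 / ∑ k, a k * z k ^ 2
        ∂(Measure.pi fun _ : ι => gaussianReal 0 1)) := by
  rw [multivariateGaussian_eq_map_pi hW b ha hb,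
    integral_map (Measurable.aemeasurable (by fun_prop))
      (Measurable.aestronglyMeasurable (by fun_prop)), ← integral_sq_div_eq_sum ha]
  congr 1
  funext z
  have h1 : inner ℝ x (∑ i, (√(a i) * z i) • b i) =
      ∑ i, inner ℝ x (b i) * (√(a i) * z i) := by
    rw [inner_sum]
    exact Finset.sum_congr rfl fun i _ => by rw [real_inner_smul_right, mul_comm]
  have h2 : ‖∑ i, (√(a i) * z i) • b i‖ ^ 2 = ∑ k, a k * z k ^ 2 := by
    rw [← b.sum_sq_inner_right]
    refine Finset.sum_congr rfl fun i _ => ?_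
    rw [b.orthonormal.inner_right_fintype, mul_pow, Real.sq_sqrt (ha i)]
  rw [h1, h2]

end Eigenbasis

/-! ### Gaussian matrices -/

section GaussianMatrix

variable {n m : ℕ}

lemma measurable_normalizedOuter_unvec (p q : Fin m × Fin n) :
    Measurable fun g : EuclideanSpace ℝ (Fin m × Fin n) => normalizedOuter (unvec g) p q := by
  have hu : Continuous fun g : EuclideanSpace ℝ (Fin m × Fin n) => (unvec g) := by
    refine continuous_matrix fun i j => ?_
    simp only [unvec, Matrix.of_apply]
    fun_prop
  have hs : Measurable fun g : EuclideanSpace ℝ (Fin m × Fin n) => sigmaMax (unvec g) :=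
    (continuous_sigmaMax.comp hu).measurable
  simp only [normalizedOuter, Matrix.smul_apply, Matrix.vecMulVec_apply, Matrix.vec, unvec,
    Matrix.of_apply, smul_eq_mul] at hs ⊢
  fun_prop

lemma integrable_normalizedOuter {Ω : Type*} [MeasurableSpace Ω] {P : Measure Ω}
    {G : Ω → Matrix (Fin n) (Fin m) ℝ} {W : Matrix (Fin m × Fin n) (Fin m × Fin n) ℝ}
    (hG : IsGaussianMatrix P G W) (p q : Fin m × Fin n) :
    Integrable (fun ω => normalizedOuter (G ω) p q) P := by
  have hP : IsProbabilityMeasure P := hG.isProbabilityMeasure_iff.2 inferInstance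
  refine Integrable.of_bound ?_ 1 (Eventually.of_forall fun ω => abs_normalizedOuter_le_one _ p q)
  exact ((measurable_normalizedOuter_unvec p q).comp_aemeasurable
    hG.aemeasurable).aestronglyMeasurable

lemma isGaussianMatrix_unvec (W : Matrix (Fin m × Fin n) (Fin m × Fin n) ℝ) :
    IsGaussianMatrix (multivariateGaussian 0 W) (unvec (n := n) (m := m)) W :=
  HasLaw.id

/-- The normalized second moment depends only on the law of `G`. -/
lemma normalizedSecondMoment_eq {Ω : Type*} [MeasurableSpace Ω] {P : Measure Ω}
    {G : Ω → Matrix (Fin n) (Fin m) ℝ} {W : Matrix (Fin m × Fin n) (Fin m × Fin n) ℝ}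
    (hG : IsGaussianMatrix P G W) :
    normalizedSecondMoment P G = normalizedSecondMoment (multivariateGaussian 0 W) unvec := by
  ext p q
  exact hG.integral_comp (measurable_normalizedOuter_unvec p q).aestronglyMeasurable

lemma dotProduct_normalizedSecondMoment {Ω : Type*} [MeasurableSpace Ω] {P : Measure Ω}
    {G : Ω → Matrix (Fin n) (Fin m) ℝ} {W : Matrix (Fin m × Fin n) (Fin m × Fin n) ℝ}
    (hG : IsGaussianMatrix P G W) (v : Fin m × Fin n → ℝ) :
    Integrable (fun ω => (v ⬝ᵥ (G ω).vec) ^ 2 / sigmaMax (G ω) ^ 2) P ∧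
    v ⬝ᵥ (normalizedSecondMoment P G).mulVec v =
      ∫ ω, (v ⬝ᵥ (G ω).vec) ^ 2 / sigmaMax (G ω) ^ 2 ∂P := by
  have hi (p q) := ((integrable_normalizedOuter hG p q).mul_const (v q)).const_mul (v p)
  have he (ω) : (v ⬝ᵥ (G ω).vec) ^ 2 / sigmaMax (G ω) ^ 2 =
      ∑ p, ∑ q, v p * (normalizedOuter (G ω) p q * v q) := by
    rw [← dotProduct_normalizedOuter_mulVec]
    simp only [dotProduct, Matrix.mulVec, Finset.mul_sum]
  simp only [he]
  refine ⟨integrable_finsetSum _ fun p _ => integrable_finsetSum _ fun q _ => hi p q, ?_⟩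
  rw [integral_finsetSum _ fun p _ => integrable_finsetSum _ fun q _ => hi p q]
  simp only [dotProduct, Matrix.mulVec, Finset.mul_sum]
  refine Finset.sum_congr rfl fun p _ => ?_
  rw [integral_finsetSum _ fun q _ => hi p q]
  refine Finset.sum_congr rfl fun q _ => ?_
  rw [integral_const_mul, integral_mul_const]
  rfl

lemma isHermitian_normalizedSecondMoment {Ω : Type*} [MeasurableSpace Ω] (P : Measure Ω)
    (G : Ω → Matrix (Fin n) (Fin m) ℝ) : (normalizedSecondMoment P G).IsHermitian := by
  ext p q
  simp [normalizedSecondMoment, normalizedOuter, Matrix.vecMulVec_apply, mul_comm]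

/-- Replacing `σ_max` by the Frobenius norm decreases the normalized moment in each direction. -/
lemma sq_div_norm_sq_le (g x : EuclideanSpace ℝ (Fin m × Fin n)) :
    inner ℝ x g ^ 2 / ‖g‖ ^ 2 ≤
      ((x : Fin m × Fin n → ℝ) ⬝ᵥ (unvec g).vec) ^ 2 / sigmaMax (unvec g) ^ 2 := by
  have hin : inner ℝ x g = (x : Fin m × Fin n → ℝ) ⬝ᵥ (unvec g).vec := by
    rw [EuclideanSpace.inner_eq_star_dotProduct, dotProduct_comm]
    rfl
  have hle : sigmaMax (unvec g) ^ 2 ≤ ‖g‖ ^ 2 := by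
    rw [EuclideanSpace.real_norm_sq_eq]
    exact sigmaMax_sq_le (unvec g)
  rw [hin]
  rcases (sq_nonneg (sigmaMax (unvec g))).eq_or_lt with h0 | h0
  · -- `σ_max = 0` forces `g = 0`, and both sides vanish
    have hz : (unvec g).vec = 0 := by
      funext p
      have := vec_sq_le_sigmaMax_sq (unvec g) p
      rw [← h0] at this
      exact pow_eq_zero_iff two_ne_zero |>.1 (le_antisymm this (sq_nonneg _))
    simp [hz]
  · exact div_le_div_of_nonneg_left (sq_nonneg _) h0 hle

lemma trace_of_isShorFeasible {W : Matrix (Fin m × Fin n) (Fin m × Fin n) ℝ}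
    (hW : IsShorFeasible W) : W.trace = m := by
  have h (j) := hW.trace_block j j
  simp only [if_true, Matrix.trace, block, Matrix.diag, Matrix.of_apply] at h
  rw [Matrix.trace, Fintype.sum_prod_type]
  simp [h]

/-- The semidefinite inequality. As `σ_max(G)² ≤ ‖vec G‖²`, it follows by comparing, in each
eigendirection of `W`, the normalized moment with `β_{n,m}`; the eigenvalues sum to `m`. -/
lemma posSemidef_normalizedSecondMoment_sub (hn : 1 ≤ n) (hm : 1 ≤ m) {Ω : Type*}
    [MeasurableSpace Ω] {P : Measure Ω} {G : Ω → Matrix (Fin n) (Fin m) ℝ}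
    {W : Matrix (Fin m × Fin n) (Fin m × Fin n) ℝ} (hW : W.PosSemidef) (htr : W.trace = m)
    (hG : IsGaussianMatrix P G W) :
    (normalizedSecondMoment P G - betaConst n m • W).PosSemidef := by
  rw [normalizedSecondMoment_eq hG]
  refine Matrix.PosSemidef.of_dotProduct_mulVec_nonneg
    ((isHermitian_normalizedSecondMoment _ _).sub (hW.1.smul (by simp [IsSelfAdjoint]))) fun v => ?_
  simp only [star_trivial]
  rw [Matrix.sub_mulVec, Matrix.smul_mulVec, dotProduct_sub, dotProduct_smul, sub_nonneg,
    smul_eq_mul]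
  set x : EuclideanSpace ℝ (Fin m × Fin n) := WithLp.toLp 2 v
  set b := hW.1.eigenvectorBasis
  set a := hW.1.eigenvalues with ha_def
  have ha : ∀ i, 0 ≤ a i := hW.eigenvalues_nonneg
  have hb : ∀ i, W.mulVec (b i) = a i • (b i : Fin m × Fin n → ℝ) := hW.1.mulVec_eigenvectorBasis
  have hsum : ∑ i, a i = m := by
    rw [← htr, hW.1.trace_eq_sum_eigenvalues]
    simp [ha_def]
  have hcard : Fintype.card (Fin m × Fin n) = n * m := by simp [mul_comm]
  have hquad : v ⬝ᵥ W.mulVec v = ∑ i, a i * inner ℝ x (b i) ^ 2 :=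
    dotProduct_mulVec_eq_sum hW.1 b hb x
  obtain ⟨hint, hmom⟩ := dotProduct_normalizedSecondMoment (isGaussianMatrix_unvec W) v
  rw [hmom, hquad, Finset.mul_sum]
  calc ∑ i, betaConst n m * (a i * inner ℝ x (b i) ^ 2)
      ≤ ∑ i, inner ℝ x (b i) ^ 2 * (a i * ∫ z : Fin m × Fin n → ℝ, z i ^ 2 / ∑ k, a k * z k ^ 2
        ∂(Measure.pi fun _ => gaussianReal 0 1)) := by
        refine Finset.sum_le_sum fun i _ => ?_
        rcases (ha i).eq_or_lt with h0 | h0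
        · simp [← h0]
        have hm0 : (0 : ℝ) < m := by exact_mod_cast hm
        have hl : a i / m ∈ Icc (0 : ℝ) 1 := by
          refine ⟨by positivity, div_le_one_of_le₀ ?_ hm0.le⟩
          rw [← hsum]
          exact Finset.single_le_sum (fun j _ => ha j) (Finset.mem_univ i)
        have hle := (ofReal_betaConst_le hn hm hl).trans
          (betaIntegral_le_lintegral_pi_ratio hcard ha hsum h0 (mul_div_cancel₀ _ hm0.ne').symm)
        rw [← ofReal_integral_sq_div ha h0, ENNReal.ofReal_le_ofReal_iff
          (integral_nonneg fun z => div_nonneg (sq_nonneg _)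
            (Finset.sum_nonneg fun k _ => mul_nonneg (ha k) (sq_nonneg _)))] at hle
        rw [mul_comm, mul_comm (a i), mul_assoc]
        gcongr
    _ = ∫ g, inner ℝ x g ^ 2 / ‖g‖ ^ 2 ∂(multivariateGaussian 0 W) :=
        (integral_inner_sq_div_norm_sq hW b ha hb x).symm
    _ ≤ _ := integral_mono_of_nonneg (Eventually.of_forall fun g => by positivity) hint
        (Eventually.of_forall fun g => sq_div_norm_sq_le g x)

end GaussianMatrix

/-! ### Tightness for a single column -/

/-- The diagonal of a covariance with eigenvalue `l` on the coordinate `p₀`, the remaining trace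
`1 - l` being spread equally over the other coordinates. For `n = 1` there are none, and the
division by zero in the second branch is never evaluated. -/
noncomputable def spreadWeights {n : ℕ} (l : ℝ) (p₀ p : Fin 1 × Fin n) : ℝ :=
  if p = p₀ then l else (1 - l) / ((n : ℝ) - 1)

lemma spreadWeights_nonneg {n : ℕ} (hn : 1 ≤ n) {l : ℝ} (hl0 : 0 ≤ l) (hl1 : l ≤ 1)
    (p₀ p : Fin 1 × Fin n) : 0 ≤ spreadWeights l p₀ p := by
  have : (1 : ℝ) ≤ n := by exact_mod_cast hn
  unfold spreadWeights
  split_ifs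
  · exact hl0
  · exact div_nonneg (by linarith) (by linarith)

lemma sum_spreadWeights {n : ℕ} {l : ℝ} (hn : n = 1 → l = 1) (p₀ : Fin 1 × Fin n) :
    ∑ p, spreadWeights l p₀ p = 1 := by
  have hpos : 1 ≤ n := p₀.2.pos
  have hc : ((Finset.univ.erase p₀).card : ℝ) = n - 1 := by
    rw [Finset.card_erase_of_mem (Finset.mem_univ _)]
    simp [Nat.cast_sub hpos]
  rw [← Finset.add_sum_erase _ _ (Finset.mem_univ p₀), Finset.sum_congr rfl
    (g := fun _ => (1 - l) / ((n : ℝ) - 1))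
    (fun p hp => by rw [spreadWeights, if_neg (Finset.ne_of_mem_erase hp)])]
  rw [Finset.sum_const, nsmul_eq_mul, hc, spreadWeights, if_pos rfl]
  by_cases h : n = 1
  · simp [hn h]
  · have : (n : ℝ) - 1 ≠ 0 := sub_ne_zero.2 (by exact_mod_cast h)
    field_simp
    ring

/-- For `m = 1` the bound by the identity is automatic: the eigenvalues are at most the trace. -/
lemma isShorFeasible_diagonal {n : ℕ} {a : Fin 1 × Fin n → ℝ} (ha : ∀ p, 0 ≤ a p)
    (hsum : ∑ p, a p = 1) : IsShorFeasible (Matrix.diagonal a) where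
  posSemidef := Matrix.PosSemidef.diagonal ha
  trace_block j j' := by
    obtain rfl := Subsingleton.elim j 0
    obtain rfl := Subsingleton.elim j' 0
    rw [Fintype.sum_prod_type, Fin.sum_univ_one] at hsum
    simpa [Matrix.trace, block] using hsum
  sum_block_le_one := by
    have h : (1 : Matrix (Fin n) (Fin n) ℝ) - ∑ j, block (Matrix.diagonal a) j j =
        Matrix.diagonal fun i => 1 - a (0, i) := by
      ext i i'
      by_cases hi : i = i' <;> simp [block, Matrix.diagonal_apply, hi]
    rw [h]
    refine Matrix.PosSemidef.diagonal fun i => sub_nonneg.2 ?_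
    rw [← hsum]
    exact Finset.single_le_sum (fun p _ => ha p) (Finset.mem_univ _)

/-- With the identity as objective every feasible point is optimal, since its trace is `m`. -/
lemma isShorSolution_one {n m : ℕ} {W : Matrix (Fin m × Fin n) (Fin m × Fin n) ℝ}
    (hW : IsShorFeasible W) : IsShorSolution 1 W :=
  ⟨hW, fun W' hW' => by
    simp [trace_of_isShorFeasible hW, trace_of_isShorFeasible hW']⟩

/-- For `n = 1` the trace constraint forces the weight `1`, so the minimizer has to be `1`. -/
lemma exists_pos_min_betaIntegral_col {n : ℕ} (hn : 1 ≤ n) :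
    ∃ l, 0 < l ∧ l ≤ 1 ∧ betaIntegral n 1 l = ENNReal.ofReal (betaConst n 1) ∧
      (n = 1 → l = 1) := by
  obtain ⟨l, hl0, hl1, h, hmin⟩ := exists_pos_min_betaIntegral hn le_rfl
  by_cases h1 : n = 1
  · subst h1
    -- for `nm = 1` the integral is decreasing in `l`, so `l = 1` is a minimizer
    refine ⟨1, one_pos, le_rfl, le_antisymm ?_ (ofReal_betaConst_le le_rfl le_rfl (by simp)),
      fun _ => rfl⟩
    rw [← h]
    refine setLIntegral_mono' measurableSet_Ioi fun t ht => ENNReal.ofReal_le_ofReal ?_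
    have ht0 : 0 < t := ht
    simp only [Nat.cast_one, mul_one, sub_self, neg_zero, zero_div, Real.rpow_zero, one_mul]
    refine Real.rpow_le_rpow_of_nonpos (by positivity) ?_ (by norm_num)
    nlinarith
  · exact ⟨l, hl0, hl1, h, fun h' => absurd h' h1⟩

/-- The covariance `spreadWeights`, at a minimizing `l`, attains equality along its special
coordinate. -/
lemma exists_tight {n : ℕ} (hn : 1 ≤ n) :
    ∃ A W : Matrix (Fin 1 × Fin n) (Fin 1 × Fin n) ℝ, A.PosSemidef ∧ IsShorSolution A W ∧
      ∃ v : Fin 1 × Fin n → ℝ, 0 < v ⬝ᵥ W.mulVec v ∧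
        v ⬝ᵥ (normalizedSecondMoment (multivariateGaussian 0 W) unvec).mulVec v =
          betaConst n 1 * (v ⬝ᵥ W.mulVec v) := by
  obtain ⟨l, hl0, hl1, h, hn1⟩ := exists_pos_min_betaIntegral_col hn
  set p₀ : Fin 1 × Fin n := (0, ⟨0, hn⟩)
  set a : Fin 1 × Fin n → ℝ := spreadWeights l p₀ with ha_def
  have ha : ∀ p, 0 ≤ a p := spreadWeights_nonneg hn hl0.le hl1 p₀
  have ha0 : a p₀ = l := by simp [ha_def, spreadWeights]
  have hfeas : IsShorFeasible (Matrix.diagonal a) :=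
    isShorFeasible_diagonal ha (sum_spreadWeights hn1 p₀)
  have hquad : Pi.single p₀ 1 ⬝ᵥ (Matrix.diagonal a).mulVec (Pi.single p₀ 1) = l := by
    simp [ha0]
  refine ⟨1, Matrix.diagonal a, Matrix.PosSemidef.one, isShorSolution_one hfeas, Pi.single p₀ 1,
    hquad ▸ hl0, ?_⟩
  rw [hquad, (dotProduct_normalizedSecondMoment (isGaussianMatrix_unvec _) _).2]
  have hfun : ∀ g : EuclideanSpace ℝ (Fin 1 × Fin n),
      ((Pi.single p₀ 1 : Fin 1 × Fin n → ℝ) ⬝ᵥ (unvec g).vec) ^ 2 / sigmaMax (unvec g) ^ 2 =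
        inner ℝ (EuclideanSpace.basisFun _ ℝ p₀) g ^ 2 / ‖g‖ ^ 2 := by
    intro g
    rw [sigmaMax_sq_of_col, EuclideanSpace.real_norm_sq_eq]
    simp [Matrix.vec, unvec, EuclideanSpace.inner_single_left, Function.uncurry, flip]
  simp only [hfun]
  rw [integral_inner_sq_div_norm_sq hfeas.posSemidef (EuclideanSpace.basisFun _ ℝ) ha
    (fun p => by ext q; simp [Pi.single_apply]), Finset.sum_eq_single p₀]
  · have hb := betaIntegral_eq_lintegral_pi_ratio (n := n) (m := 1) (by simp) ha (i := p₀)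
      (ha0 ▸ hl0) (l := l) (by simp [ha0])
      (fun p hp => by simp [ha_def, spreadWeights, hp])
    rw [h, ← ofReal_integral_sq_div ha (ha0 ▸ hl0)] at hb
    have hb' := (ENNReal.ofReal_eq_ofReal_iff (betaConst_nonneg n 1)
      (integral_nonneg fun z => div_nonneg (sq_nonneg _)
        (Finset.sum_nonneg fun k _ => mul_nonneg (ha k) (sq_nonneg _)))).1 hb
    rw [hb', ha0]
    simp [mul_comm]
  · intro p _ hp
    rw [(EuclideanSpace.basisFun _ ℝ).inner_eq_zero hp.symm]
    simp
  · simp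

/-! ### The guarantee for the Gaussian matrix and the constants -/

theorem theorem2 :
    -- the minimum defining `β_{n,m}` is attained and finite
    (∀ n m : ℕ, 1 ≤ n → 1 ≤ m →
      IsLeast (betaIntegral n m '' Icc (0 : ℝ) 1) (ENNReal.ofReal (betaConst n m))) ∧
    -- the semidefinite inequality for the Gaussian matrix generated by the algorithm
    (∀ n m : ℕ, 1 ≤ n → 1 ≤ m →
      ∀ A W : Matrix (Fin m × Fin n) (Fin m × Fin n) ℝ, A.PosSemidef → IsShorSolution A W →
      ∀ (Ω : Type*) [MeasurableSpace Ω] (P : Measure Ω) (G : Ω → Matrix (Fin n) (Fin m) ℝ),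
        IsGaussianMatrix P G W →
        (∀ p q, Integrable (fun ω => normalizedOuter (G ω) p q) P) ∧
        (normalizedSecondMoment P G - betaConst n m • W).PosSemidef) ∧
    -- (a) monotonicity in `n`, and in `m`
    (∀ m n n' : ℕ, 1 ≤ m → 1 ≤ n → n ≤ n' → betaConst n' m ≤ betaConst n m) ∧
    (∀ n m m' : ℕ, 1 ≤ m → m ≤ m' → m' ≤ n → betaConst n m' ≤ betaConst n m) ∧
    -- (b) the limit as `n → ∞` and its two expressions
    (∀ m : ℕ, 1 ≤ m →
      Tendsto (fun n : ℕ => betaConst n m) atTop (𝓝 (betaConstInf m)) ∧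
      IsLeast (betaInfIntegral m '' Icc (0 : ℝ) 1) (ENNReal.ofReal (betaConstInf m)) ∧
      (∀ l ∈ Icc (0 : ℝ) 1,
        Integrable (fun x : ℝ => x / (m * (1 - l) + m * l * x)) chiSquaredOne) ∧
      IsLeast ((fun l : ℝ => ∫ x, x / (m * (1 - l) + m * l * x) ∂chiSquaredOne) '' Icc (0 : ℝ) 1)
        (betaConstInf m)) ∧
    -- (c) for `m = 1` the inequality is tight: for some `W` it holds with equality in a
    -- direction `v` with `vᵀ W v > 0`, so that `β_{n,1}` is the best constant
    (∀ n : ℕ, 1 ≤ n →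
      (∃ A W : Matrix (Fin 1 × Fin n) (Fin 1 × Fin n) ℝ, A.PosSemidef ∧ IsShorSolution A W ∧
        ∃ v : Fin 1 × Fin n → ℝ, 0 < v ⬝ᵥ W.mulVec v ∧
          v ⬝ᵥ (normalizedSecondMoment (multivariateGaussian 0 W) unvec).mulVec v =
            betaConst n 1 * (v ⬝ᵥ W.mulVec v)) ∧
      IsGreatest {c : ℝ | ∀ A W : Matrix (Fin 1 × Fin n) (Fin 1 × Fin n) ℝ,
          A.PosSemidef → IsShorSolution A W →
          (normalizedSecondMoment (multivariateGaussian 0 W) unvec - c • W).PosSemidef}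
        (betaConst n 1)) := by
  refine ⟨fun n m hn hm => ?_, fun n m hn hm A W _ hW Ω _ P G hG => ?_,
    fun m n n' hm hn hnn => betaConst_anti hn hm hnn le_rfl,
    fun n m m' hm hmm hn => betaConst_anti (hm.trans (hmm.trans hn)) hm le_rfl hmm,
    fun m hm => ⟨tendsto_betaConst hm, ?_, fun l hl => integrable_chiSquaredOne hm hl, ?_⟩,
    fun n hn => ?_⟩
  · obtain ⟨l, hl0, hl1, h, hmin⟩ := exists_pos_min_betaIntegral hn hm
    exact ⟨⟨l, ⟨hl0.le, hl1⟩, h⟩, fun y ⟨l', hl', hy⟩ => hy ▸ h ▸ hmin l' hl'⟩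
  · exact ⟨integrable_normalizedOuter hG, posSemidef_normalizedSecondMoment_sub hn hm
      hW.1.posSemidef (trace_of_isShorFeasible hW.1) hG⟩
  · obtain ⟨l, hl0, hl1, h, hmin⟩ := exists_pos_min_betaInfIntegral hm
    exact ⟨⟨l, ⟨hl0.le, hl1⟩, h⟩, fun y ⟨l', hl', hy⟩ => hy ▸ h ▸ hmin l' hl'⟩
  · obtain ⟨l, hl0, hl1, h, hmin⟩ := exists_pos_min_betaInfIntegral hm
    have hl : l ∈ Icc (0 : ℝ) 1 := ⟨hl0.le, hl1⟩
    have hβ : (betaInfIntegral m l).toReal = betaConstInf m := by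
      rw [h, ENNReal.toReal_ofReal (show 0 ≤ betaConstInf m from ENNReal.toReal_nonneg)]
    refine ⟨⟨l, hl, (integral_chiSquaredOne hm hl).trans hβ⟩, fun y ⟨l', hl', hy⟩ => ?_⟩
    rw [← hy, ← hβ]
    exact (ENNReal.toReal_mono (betaInfIntegral_ne_top hm hl') (hmin l' hl')).trans
      (integral_chiSquaredOne hm hl').ge
  · obtain ⟨A, W, hA, hW, v, hv, heq⟩ := exists_tight hn
    refine ⟨⟨A, W, hA, hW, v, hv, heq⟩, fun A' W' _ hW' =>
      posSemidef_normalizedSecondMoment_sub hn le_rfl hW'.1.posSemidef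
        (trace_of_isShorFeasible hW'.1) (isGaussianMatrix_unvec W'), fun c hc => ?_⟩
    have h := (hc A W hA hW).dotProduct_mulVec_nonneg v
    simp only [star_trivial] at h
    rw [Matrix.sub_mulVec, Matrix.smul_mulVec, dotProduct_sub, dotProduct_smul, sub_nonneg,
      smul_eq_mul, heq] at h
    exact le_of_mul_le_mul_right h hv
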